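/- Let $\alpha,\theta,\sigma\in\mathbb R$, let $B=(B(t))_{t\ge 0}$ be a standard real Brownian motion on a probability space $(\Omega,\mathcal F,P)$, and let $\xi$ be a real random variable on the same space, independent of $B$, with $\mathbb E|\xi|^3<\infty$. Let $\mu_0\in\mathbb R$, and consider the nonlinear (McKean–Vlasov) equation $$dx(t)=\left(-x^3(t)+x(t)\right)dt-\mu(t)\,dt+\sigma\,dB(t),\qquad \frac{d\mu}{dt}(t)=-(\alpha-\theta)\mu(t)+\theta\,\mathbb E\left[x^3(t)-x(t)\right],\qquad t\ge 0,$$ with $x(0)=\xi$ and $\mu(0)=\mu_0$. A solution is a pair $(x,\mu)$ of a real process $x=(x(t))_{t\ge0}$ on $(\Omega,\mathcal F,P)$ with almost surely continuous paths and a deterministic differentiable function $\mu:[0,\infty)\to\mathbb R$ such that $x^3(t)-x(t)$ is integrable for every $t\ge0$, the second equation holds for every $t\ge 0$ (with the one-sided derivative at $0$), the initial conditions hold (the first almost surely), and almost surely, for all $t\ge 0$, $$x(t)=\xi+\int_0^t\left(-x^3(s)+x(s)-\mu(s)\right)ds+\sigma B(t).$$ It is a strong solution if, moreover, $x$ is adapted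 to the filtration generated by $\xi$ and $B$, augmented by the $P$-null sets. Then the equation has a unique strong solution: there is a strong solution $(x,\mu)$, and every solution $(y,\nu)$ for the same $B$, $\xi$ and $\mu_0$, strong or not, satisfies $P\left(y(t)=x(t)\text{ for all }t\ge 0\right)=1$ and $\nu(t)=\mu(t)$ for all $t\ge 0$. -/

import Mathlib

open MeasureTheory ProbabilityTheory Filter Set
open scoped NNReal

namespace CubicMcKeanVlasov

variable {Ω : Type*} [mΩ : MeasurableSpace Ω]

/-- The σ-algebra `σ(ξ, B s : s ≤ t)` generated by the initial value and by the noise up to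
time `t`. -/
@[reducible] def inputSigma (ξ : Ω → ℝ) (B : ℝ≥0 → Ω → ℝ) (t : ℝ≥0) : MeasurableSpace Ω :=
  MeasurableSpace.comap ξ inferInstance ⊔
    ⨆ s : Set.Iic t, MeasurableSpace.comap (B s) inferInstance

/-- The augmentation of `σ(ξ, B s : s ≤ t)` by the `P`-null sets: it consists of the sets that
differ from a set of `σ(ξ, B s : s ≤ t)` by a `P`-null set. -/
@[reducible] def augmentedSigma (P : Measure Ω) (ξ : Ω → ℝ) (B : ℝ≥0 → Ω → ℝ) (t : ℝ≥0) :
    MeasurableSpace Ω :=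
  eventuallyMeasurableSpace (inputSigma ξ B t) (ae P)

/-- The pair `(x, μ)`, a real process with almost surely continuous paths and a deterministic
function (only its values on `[0, ∞)` matter), satisfies
`dx = (-x³ + x) dt - μ dt + σ dB`, `dμ/dt = -(α - θ) μ + θ E[x³ - x]`,
`x(0) = ξ`, `μ(0) = μ₀`. The noise is additive with a constant coefficient, so that its stochastic
integral over `[0, t]` is `σ (B t - B 0)`. The derivative at time `0` is one-sided.
No adaptedness is required here. -/
structure IsSolution (P : Measure Ω) (α θ σ μ₀ : ℝ) (B : ℝ≥0 → Ω → ℝ) (ξ : Ω → ℝ)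
    (x : ℝ≥0 → Ω → ℝ) (μ : ℝ → ℝ) : Prop where
  aemeasurable : ∀ t, AEMeasurable (x t) P
  continuous_paths : ∀ᵐ ω ∂P, Continuous fun t : ℝ≥0 => x t ω
  init_x : ∀ᵐ ω ∂P, x 0 ω = ξ ω
  init_mu : μ 0 = μ₀
  eq_x : ∀ᵐ ω ∂P, ∀ t : ℝ≥0,
    x t ω = x 0 ω
      + (∫ s in (0 : ℝ)..t, (-(x s.toNNReal ω) ^ 3 + x s.toNNReal ω - μ s))
      + σ * (B t ω - B 0 ω)
  integrable : ∀ t, Integrable (fun ω => x t ω ^ 3 - x t ω) P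
  eq_mu : ∀ t : ℝ≥0,
    HasDerivWithinAt μ (-(α - θ) * μ t + θ * ∫ ω, (x t ω ^ 3 - x t ω) ∂P) (Set.Ici 0) t

/-- A strong solution: a solution on the given probability space, for the given Brownian motion
and initial value, that is adapted to the augmented filtration generated by these two. -/
structure IsStrongSolution (P : Measure Ω) (α θ σ μ₀ : ℝ) (B : ℝ≥0 → Ω → ℝ) (ξ : Ω → ℝ)
    (x : ℝ≥0 → Ω → ℝ) (μ : ℝ → ℝ) : Prop
    extends IsSolution P α θ σ μ₀ B ξ x μ where
  adapted : ∀ t, Measurable[augmentedSigma P ξ B t] (x t)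

end CubicMcKeanVlasov

/-! The noise is additive, so for a fixed continuous `m` the equation for `x` is solved path by
path: with `w = σ (B - B 0)`, the difference `x - w` solves an ordinary differential equation. The
drift `-x³ + x` is one-sided Lipschitz, since the cube only pulls two solutions together. This gives
a priori bounds, existence (`exists_solves`) and stability in the data with nonrandom constants
(`Solves.abs_sub_le`).

The remaining unknown is the deterministic `m`. Estimating `E[x³ - x]` directly in terms of `m`
would bring in the non-Lipschitz cube. Instead, taking expectations in the equation for `x`
expresses `∫ E[x³ - x]` as `E[ξ + w(t)] - ∫ m - E x(t)` (`integral_process`), and the mean-field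
equation becomes `m(t) = μ₀ - α ∫ m + θ (E[ξ + w(t)] - E x(t))`. By stability `E x(t)` is Lipschitz
in `∫ |m - m'|`, so this is a Volterra equation with exactly one solution
(`existsUnique_meanField`). The third moment of `ξ` and the Gaussian moments of `w` make the
expectations finite and continuous in time.

Any solution `(y, ν)` is pathwise the solution driven by `ν`, so `ν` solves the same Volterra
equation; this gives uniqueness. Adaptedness holds because the path at time `t` is a continuous
function of the initial value and of the noise on `[0, t]` (`measurable_sol`). -/

namespace CubicMcKeanVlasov

/-! ### Comparison for scalar differential inequalities -/

/-- A function whose growth rate is less than `u + c` as long as it is above the level `a` stays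
below the solution of `v' = v + exp t * c t`, `v 0 = a`. -/
theorem le_exp_mul_add_integral {u F c : ℝ → ℝ} {a T : ℝ} (hc : Continuous c)
    (hc0 : ∀ t, 0 ≤ c t) (ha : 0 ≤ a) (hu0 : u 0 ≤ a)
    (hu : ∀ t, HasDerivAt u (F t) t)
    (hF : ∀ t ∈ Ico 0 T, a ≤ u t → F t < u t + c t) :
    ∀ t ∈ Icc 0 T, u t ≤ Real.exp t * (a + ∫ s in (0 : ℝ)..t, c s) := by
  have hB : ∀ t, HasDerivAt (fun t => Real.exp t * (a + ∫ s in (0 : ℝ)..t, c s))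
      (Real.exp t * (a + ∫ s in (0 : ℝ)..t, c s) + Real.exp t * c t) t := fun t =>
    (Real.hasDerivAt_exp t).mul ((hc.integral_hasStrictDerivAt 0 t).hasDerivAt.const_add a)
  have key := image_le_of_deriv_right_lt_deriv_boundary' (f := u) (f' := F) (a := 0) (b := T)
    (fun t _ => (hu t).continuousAt.continuousWithinAt) (fun t _ => (hu t).hasDerivWithinAt)
    (B := fun t => Real.exp t * (a + ∫ s in (0 : ℝ)..t, c s)) (by simpa using hu0)
    (fun t _ => (hB t).continuousAt.continuousWithinAt) (fun t _ => (hB t).hasDerivWithinAt)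
    (fun t ht heq => by
      have hexp : 1 ≤ Real.exp t := Real.one_le_exp ht.1
      have hint : 0 ≤ ∫ s in (0 : ℝ)..t, c s :=
        intervalIntegral.integral_nonneg ht.1 fun s _ => hc0 s
      have hle : a ≤ u t := by rw [heq]; nlinarith
      have := hF t ht hle
      nlinarith [hc0 t])
  exact fun t ht => key ht

/-! ### Volterra equations by Picard iteration -/

section Volterra

variable {Φ : C(ℝ, ℝ) → C(ℝ, ℝ)}

/-- Integrating the Lipschitz bound `n` times produces the factorial. Allowing two Picard orbits
covers both uses: constant orbits at two fixed points give uniqueness, and an orbit against its own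
shift gives convergence. -/
theorem abs_sub_le_of_volterra {K C T : ℝ} (hK : 0 ≤ K)
    (hΦ : ∀ m m' : C(ℝ, ℝ), ∀ t ∈ Icc 0 T,
      |Φ m t - Φ m' t| ≤ K * ∫ s in (0 : ℝ)..t, |m s - m' s|)
    {a b : ℕ → C(ℝ, ℝ)} (ha : ∀ n, ∀ t ∈ Icc 0 T, a (n + 1) t = Φ (a n) t)
    (hb : ∀ n, ∀ t ∈ Icc 0 T, b (n + 1) t = Φ (b n) t)
    (h0 : ∀ t ∈ Icc 0 T, |a 0 t - b 0 t| ≤ C) (n : ℕ) :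
    ∀ t ∈ Icc 0 T, |a n t - b n t| ≤ C * ((K * t) ^ n / n.factorial) := by
  induction n with
  | zero => simpa using h0
  | succ n ih =>
    intro t ht
    rw [ha n t ht, hb n t ht]
    refine (hΦ _ _ t ht).trans ?_
    have h1 : ∫ s in (0 : ℝ)..t, |a n s - b n s| ≤
        ∫ s in (0 : ℝ)..t, C * ((K * s) ^ n / n.factorial) := by
      refine intervalIntegral.integral_mono_on ht.1 ?_ ?_ fun s hs => ih s ⟨hs.1, hs.2.trans ht.2⟩
      · exact Continuous.intervalIntegrable (by fun_prop) _ _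
      · exact Continuous.intervalIntegrable (by fun_prop) _ _
    refine (mul_le_mul_of_nonneg_left h1 hK).trans (le_of_eq ?_)
    have h2 : ∀ s : ℝ, C * ((K * s) ^ n / n.factorial) = (C * K ^ n / n.factorial) * s ^ n := by
      intro s; rw [mul_pow]; ring
    simp_rw [h2]
    rw [intervalIntegral.integral_const_mul, integral_pow, Nat.factorial_succ]
    have := Nat.factorial_ne_zero n
    push_cast
    field_simp
    ring

theorem eqOn_of_volterra
    (hΦ : ∀ T, ∃ K, 0 ≤ K ∧ ∀ m m' : C(ℝ, ℝ), ∀ t ∈ Icc 0 T,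
      |Φ m t - Φ m' t| ≤ K * ∫ s in (0 : ℝ)..t, |m s - m' s|)
    {m m' : C(ℝ, ℝ)} (hm : ∀ t, 0 ≤ t → m t = Φ m t) (hm' : ∀ t, 0 ≤ t → m' t = Φ m' t) :
    ∀ t, 0 ≤ t → m t = m' t := by
  intro T hT
  obtain ⟨K, hK, h⟩ := hΦ T
  obtain ⟨C, hC⟩ := (isCompact_Icc (a := (0 : ℝ)) (b := T)).exists_bound_of_continuousOn
    (f := fun t => m t - m' t) (by fun_prop)
  have key := fun n => abs_sub_le_of_volterra (a := fun _ => m) (b := fun _ => m') hK h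
    (fun _ t ht => hm t ht.1) (fun _ t ht => hm' t ht.1) hC n T ⟨hT, le_rfl⟩
  have hlim := (FloorSemiring.tendsto_pow_div_factorial_atTop (K * T)).const_mul C
  rw [mul_zero] at hlim
  have := ge_of_tendsto' hlim key
  exact sub_eq_zero.1 (abs_nonpos_iff.1 this)

theorem exists_fixedPoint_of_volterra
    (hΦ : ∀ T, ∃ K, 0 ≤ K ∧ ∀ m m' : C(ℝ, ℝ), ∀ t ∈ Icc 0 T,
      |Φ m t - Φ m' t| ≤ K * ∫ s in (0 : ℝ)..t, |m s - m' s|) :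
    ∃ m : C(ℝ, ℝ), ∀ t, 0 ≤ t → m t = Φ m t := by
  let a : ℕ → C(ℝ, ℝ) := fun n => Φ^[n] 0
  have ha : ∀ n, a (n + 1) = Φ (a n) := fun n => Function.iterate_succ_apply' Φ n 0
  -- Freezing the increments at `0` for negative times makes their sum continuous on all of `ℝ`,
  -- although the estimates hold only on `[0, T]`.
  let d : ℕ → ℝ → ℝ := fun n t => a (n + 1) (max t 0) - a n (max t 0)
  have hd : ∀ T, 0 ≤ T → ∃ v : ℕ → ℝ, Summable v ∧ ∀ n, ∀ t ≤ T, ‖d n t‖ ≤ v n := by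
    intro T hT
    obtain ⟨K, hK, h⟩ := hΦ T
    obtain ⟨C, hC⟩ := (isCompact_Icc (a := (0 : ℝ)) (b := T)).exists_bound_of_continuousOn
      (f := fun t => a 1 t - a 0 t) (by fun_prop)
    have hC0 : 0 ≤ C := (norm_nonneg _).trans (hC 0 ⟨le_rfl, hT⟩)
    refine ⟨fun n => C * ((K * T) ^ n / n.factorial),
      (Real.summable_pow_div_factorial (K * T)).mul_left C, fun n t ht => ?_⟩
    have := abs_sub_le_of_volterra (a := fun n => a (n + 1)) (b := a) hK h
      (fun n t _ => by rw [ha (n + 1)]) (fun n t _ => by rw [ha n]) hC n (max t 0)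
      ⟨le_max_right _ _, max_le ht hT⟩
    refine this.trans ?_
    have : max t 0 ≤ T := max_le ht hT
    change C * _ ≤ C * ((K * T) ^ n / n.factorial)
    have h0 : 0 ≤ max t 0 := le_max_right _ _
    gcongr
  have hsum : ∀ t, Summable fun n => d n t := fun t => by
    obtain ⟨v, hv, hdv⟩ := hd (max t 0) (le_max_right _ _)
    exact Summable.of_norm_bounded hv fun n => hdv n t (le_max_left _ _)
  have hcont : Continuous fun t => ∑' n, d n t := by
    rw [continuous_iff_continuousAt]
    intro t
    obtain ⟨v, hv, hdv⟩ := hd (max (t + 1) 0) (le_max_right _ _)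
    refine (continuousOn_tsum (s := Iio (t + 1)) (fun n => ?_) hv
      fun n s hs => hdv n s (hs.le.trans (le_max_left _ _))).continuousAt
        (Iio_mem_nhds (by linarith))
    simp only [d]
    fun_prop
  let m : C(ℝ, ℝ) := ⟨fun t => ∑' n, d n t, hcont⟩
  have hlim : ∀ t, 0 ≤ t → Tendsto (fun n => a n t) atTop (nhds (m t)) := by
    intro t ht
    have := (hsum t).hasSum.tendsto_sum_nat
    refine this.congr fun n => ?_
    simp only [d, max_eq_left ht]
    rw [Finset.sum_range_sub (fun n => a n t)]
    simp [a]
  refine ⟨m, fun T hT => ?_⟩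
  obtain ⟨K, hK, h⟩ := hΦ T
  obtain ⟨v, hv, hdv⟩ := hd T hT
  have htail : ∀ n, ∀ t ∈ Icc 0 T, |a n t - m t| ≤ ∑' k, v (n + k) := by
    intro n t ht
    refine dist_le_tsum_of_dist_le_of_tendsto v (fun k => ?_) hv (hlim t ht.1) n
    have := hdv k t ht.2
    simp only [d, max_eq_left ht.1] at this
    rwa [dist_comm, Real.dist_eq]
  have hr : Tendsto (fun n => K * (T * ∑' k, v (n + k))) atTop (nhds 0) := by
    have := tendsto_sum_nat_add v
    simp_rw [add_comm _ _] at this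
    simpa using (this.const_mul T).const_mul K
  have hb : ∀ n, |a (n + 1) T - Φ m T| ≤ K * (T * ∑' k, v (n + k)) := by
    intro n
    rw [ha n]
    refine (h _ _ T ⟨hT, le_rfl⟩).trans (mul_le_mul_of_nonneg_left ?_ hK)
    calc ∫ s in (0 : ℝ)..T, |a n s - m s|
        ≤ ∫ s in (0 : ℝ)..T, ∑' k, v (n + k) :=
          intervalIntegral.integral_mono_on hT (Continuous.intervalIntegrable (by fun_prop) _ _)
            (Continuous.intervalIntegrable (by fun_prop) _ _) fun s hs => htail n s hs
      _ = T * ∑' k, v (n + k) := by simp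
  have h1 : Tendsto (fun n => a (n + 1) T) atTop (nhds (Φ m T)) := by
    rw [tendsto_iff_norm_sub_tendsto_zero]
    exact squeeze_zero (fun _ => norm_nonneg _) hb hr
  exact tendsto_nhds_unique ((tendsto_add_atTop_iff_nat 1).2 (hlim T hT)) h1

end Volterra

/-! ### The pathwise equation: stability and uniqueness -/

/-- `x` solves `dx = (-x³ + x - m) dt + dw`, `x(0) = x₀ + w(0)` on `[0, ∞)`. -/
def Solves (x₀ : ℝ) (w m x : C(ℝ, ℝ)) : Prop :=
  ∀ t, 0 ≤ t → x t = x₀ + (∫ s in (0 : ℝ)..t, (-(x s) ^ 3 + x s - m s)) + w t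

theorem hasDerivAt_const_add_integral (x₀ : ℝ) {f : ℝ → ℝ} (hf : Continuous f) (t : ℝ) :
    HasDerivAt (fun t => x₀ + ∫ s in (0 : ℝ)..t, f s) (f t) t :=
  (hf.integral_hasStrictDerivAt 0 t).hasDerivAt.const_add x₀

namespace Solves

variable {x₀ x₀' : ℝ} {w m x w' m' x' : C(ℝ, ℝ)}

/-- The comparison is applied to `(x - w) - (x' - w')`, which is differentiable although the paths
need not be. Once this exceeds `|x₀ - x₀'| + ε`, the bound on `w - w'` forces `x ≥ x'`, and the
cubes contribute with the good sign. The strict bound on `w - w'` supplies the strict inequality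
that the comparison needs. -/
theorem sub_le (hx : Solves x₀ w m x) (hx' : Solves x₀' w' m' x') {T ε : ℝ}
    (hw : ∀ t ∈ Icc 0 T, |w t - w' t| < ε) :
    ∀ t ∈ Icc 0 T, x t - x' t ≤
      Real.exp t * (|x₀ - x₀'| + ε + ∫ s in (0 : ℝ)..t, (|m s - m' s| + ε)) + ε := by
  intro t ht
  have hε : 0 ≤ ε := (abs_nonneg _).trans (hw t ht).le
  have hf : Continuous fun s => -(x s) ^ 3 + x s - m s := by fun_prop
  have hf' : Continuous fun s => -(x' s) ^ 3 + x' s - m' s := by fun_prop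
  have key := le_exp_mul_add_integral (T := T) (a := |x₀ - x₀'| + ε)
    (c := fun s => |m s - m' s| + ε) (by fun_prop) (fun s => by positivity) (by positivity)
    (by simpa using (le_abs_self (x₀ - x₀')).trans (by linarith))
    (fun t => (hasDerivAt_const_add_integral x₀ hf t).sub
      (hasDerivAt_const_add_integral x₀' hf' t)) (fun s hs hle => by
        have h1 := hx s hs.1
        have h2 := hx' s hs.1
        have h3 := abs_lt.1 (hw s ⟨hs.1, hs.2.le⟩)
        have h4 := abs_le.1 (le_refl |m s - m' s|)
        simp only [Pi.sub_apply] at hle ⊢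
        rw [show x₀ + (∫ s in (0 : ℝ)..s, (-(x s) ^ 3 + x s - m s)) = x s - w s by linarith,
          show x₀' + (∫ s in (0 : ℝ)..s, (-(x' s) ^ 3 + x' s - m' s)) = x' s - w' s by linarith]
          at hle ⊢
        have hz : 0 ≤ x s - x' s := by linarith [abs_nonneg (x₀ - x₀')]
        have hcube : x' s ^ 3 ≤ x s ^ 3 :=
          (Odd.strictMono_pow (by decide : Odd 3)).monotone (sub_nonneg.1 hz)
        linarith) t ht
  have h1 := hx t ht.1
  have h2 := hx' t ht.1
  have h3 := abs_lt.1 (hw t ht)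
  simp only [Pi.sub_apply] at key
  linarith

theorem abs_sub_le (hx : Solves x₀ w m x) (hx' : Solves x₀' w' m' x') {T ε : ℝ}
    (hw : ∀ t ∈ Icc 0 T, |w t - w' t| < ε) :
    ∀ t ∈ Icc 0 T, |x t - x' t| ≤
      Real.exp t * (|x₀ - x₀'| + ε + ∫ s in (0 : ℝ)..t, (|m s - m' s| + ε)) + ε := by
  intro t ht
  rw [abs_le]
  constructor
  · have := hx'.sub_le hx (fun s hs => by rw [abs_sub_comm]; exact hw s hs) t ht
    rw [abs_sub_comm x₀'] at this
    simp_rw [abs_sub_comm (m' _)] at this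
    linarith
  · exact hx.sub_le hx' hw t ht

theorem abs_sub_le_of_eqOn (hx : Solves x₀ w m x) (hx' : Solves x₀' w' m' x') {t : ℝ}
    (ht : 0 ≤ t) (hw : ∀ s ∈ Icc 0 t, w s = w' s) :
    |x t - x' t| ≤ Real.exp t * (|x₀ - x₀'| + ∫ s in (0 : ℝ)..t, |m s - m' s|) := by
  have h : ∀ ε : ℝ, 0 < ε → |x t - x' t| ≤
      Real.exp t * (|x₀ - x₀'| + ε + ((∫ s in (0 : ℝ)..t, |m s - m' s|) + t * ε)) + ε := by
    intro ε hε
    have := hx.abs_sub_le hx' (T := t) (ε := ε)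
      (fun s hs => by rw [hw s hs, sub_self, abs_zero]; exact hε) t ⟨ht, le_rfl⟩
    rw [intervalIntegral.integral_add (Continuous.intervalIntegrable (by fun_prop) _ _)
      (Continuous.intervalIntegrable (by fun_prop) _ _)] at this
    simpa using this
  have hlim : Tendsto (fun ε : ℝ => Real.exp t * (|x₀ - x₀'| + ε +
      ((∫ s in (0 : ℝ)..t, |m s - m' s|) + t * ε)) + ε) (nhdsWithin 0 (Ioi 0))
      (nhds (Real.exp t * (|x₀ - x₀'| + ∫ s in (0 : ℝ)..t, |m s - m' s|))) := by
    have hc : Continuous fun ε : ℝ => Real.exp t * (|x₀ - x₀'| + ε +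
      ((∫ s in (0 : ℝ)..t, |m s - m' s|) + t * ε)) + ε := by fun_prop
    simpa using (hc.tendsto 0).mono_left nhdsWithin_le_nhds
  exact ge_of_tendsto hlim (eventually_nhdsWithin_of_forall h)

/-- Besides uniqueness this expresses that solutions are nonanticipating: only the data on `[0, t]`
matter. -/
theorem eq_of_eqOn (hx : Solves x₀ w m x) (hx' : Solves x₀ w' m' x') {t : ℝ}
    (ht : 0 ≤ t) (hw : ∀ s ∈ Icc 0 t, w s = w' s) (hm : ∀ s ∈ Icc 0 t, m s = m' s) :
    x t = x' t := by
  have h := hx.abs_sub_le_of_eqOn hx' ht hw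
  have h0 : ∫ s in (0 : ℝ)..t, |m s - m' s| = 0 := by
    rw [intervalIntegral.integral_congr (g := fun _ => 0), intervalIntegral.integral_zero]
    intro s hs
    rw [uIcc_of_le ht] at hs
    simp [hm s hs]
  rw [h0, sub_self, abs_zero, add_zero, mul_zero] at h
  exact sub_eq_zero.1 (abs_nonpos_iff.1 h)

end Solves

/-! ### A priori bounds and pathwise existence -/

/-- A bound for `|x - w|` on solutions of `dx = (-x³ + x - m) dt + dw`. -/
noncomputable def growthBound (x₀ : ℝ) (w m : C(ℝ, ℝ)) (t : ℝ) : ℝ :=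
  Real.exp t * (|x₀| + ∫ s in (0 : ℝ)..t, (|w s| ^ 3 + |w s| + |m s| + 1))

theorem continuous_growthBound (x₀ : ℝ) (w m : C(ℝ, ℝ)) : Continuous (growthBound x₀ w m) := by
  have : Continuous fun t => ∫ s in (0 : ℝ)..t, (|w s| ^ 3 + |w s| + |m s| + 1) :=
    intervalIntegral.continuous_primitive
      (fun a b => Continuous.intervalIntegrable (by fun_prop) a b) 0
  unfold growthBound
  fun_prop

theorem growthBound_nonneg (x₀ : ℝ) (w m : C(ℝ, ℝ)) {t : ℝ} (ht : 0 ≤ t) :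
    0 ≤ growthBound x₀ w m t := by
  have : 0 ≤ ∫ s in (0 : ℝ)..t, (|w s| ^ 3 + |w s| + |m s| + 1) :=
    intervalIntegral.integral_nonneg ht fun s _ => by positivity
  unfold growthBound
  positivity

theorem growthBound_mono (x₀ : ℝ) (w m : C(ℝ, ℝ)) {s t : ℝ} (hs : 0 ≤ s) (hst : s ≤ t) :
    growthBound x₀ w m s ≤ growthBound x₀ w m t := by
  have h0 : 0 ≤ ∫ r in (0 : ℝ)..s, (|w r| ^ 3 + |w r| + |m r| + 1) :=
    intervalIntegral.integral_nonneg hs fun s _ => by positivity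
  have h1 : ∫ r in (0 : ℝ)..s, (|w r| ^ 3 + |w r| + |m r| + 1) ≤
      ∫ r in (0 : ℝ)..t, (|w r| ^ 3 + |w r| + |m r| + 1) :=
    intervalIntegral.integral_mono_interval le_rfl hs hst
      (ae_of_all _ fun r => by positivity) (Continuous.intervalIntegrable (by fun_prop) _ _)
  unfold growthBound
  gcongr

/-- The comparison is applied to `u` and to `-u`. The drift `F` is left abstract so that the bound
serves the true drift and the truncated one alike. -/
theorem abs_le_growthBound {x₀ : ℝ} {w m : C(ℝ, ℝ)} {u F : ℝ → ℝ} (hu0 : u 0 = x₀)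
    (hu : ∀ t, HasDerivAt u (F t - m t) t)
    (hpos : ∀ t, 0 ≤ t → 0 ≤ u t → F t ≤ u t + |w t| + |w t| ^ 3)
    (hneg : ∀ t, 0 ≤ t → u t ≤ 0 → u t - |w t| - |w t| ^ 3 ≤ F t) {t : ℝ} (ht : 0 ≤ t) :
    |u t| ≤ growthBound x₀ w m t := by
  have h1 := le_exp_mul_add_integral (T := t) (a := |x₀|)
    (c := fun s => |w s| ^ 3 + |w s| + |m s| + 1) (by fun_prop) (fun s => by positivity)
    (abs_nonneg _) (hu0 ▸ le_abs_self _) hu (fun s hs hle => by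
      have := hpos s hs.1 ((abs_nonneg _).trans hle)
      linarith [neg_abs_le (m s)]) t ⟨ht, le_rfl⟩
  have h2 := le_exp_mul_add_integral (T := t) (a := |x₀|) (u := fun s => -u s)
    (c := fun s => |w s| ^ 3 + |w s| + |m s| + 1) (by fun_prop) (fun s => by positivity)
    (abs_nonneg _) (hu0 ▸ neg_le_abs _) (fun s => (hu s).neg) (fun s hs hle => by
      have := hneg s hs.1 (neg_nonneg.1 ((abs_nonneg _).trans hle))
      linarith [le_abs_self (m s)]) t ⟨ht, le_rfl⟩
  exact abs_le.2 ⟨by unfold growthBound; linarith, h1⟩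

/-- The projection of `z` to `[-R, R]`. -/
noncomputable def clamp (R z : ℝ) : ℝ := max (-R) (min R z)

theorem abs_clamp_le (R z : ℝ) : |clamp R z| ≤ |R| := by
  unfold clamp; grind

theorem abs_clamp_sub_clamp_le (R y z : ℝ) : |clamp R y - clamp R z| ≤ |y - z| := by
  unfold clamp; grind

theorem clamp_of_abs_le {R z : ℝ} (h : |z| ≤ R) : clamp R z = z := by
  unfold clamp; grind

theorem clamp_mem_Icc_of_nonneg {R z : ℝ} (hR : 0 ≤ R) (hz : 0 ≤ z) : clamp R z ∈ Icc 0 z := by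
  unfold clamp; constructor <;> grind

theorem clamp_mem_Icc_of_nonpos {R z : ℝ} (hR : 0 ≤ R) (hz : z ≤ 0) : clamp R z ∈ Icc z 0 := by
  unfold clamp; constructor <;> grind

/-- Truncation keeps the sign and does not increase the modulus. If `u + w ≥ 0` the cube helps;
otherwise `u + w` lies between `-|w|` and `0`. The bound is independent of `R`, which allows `R` to
be chosen afterwards. -/
theorem drift_clamp_le {R u w : ℝ} (hR : 0 ≤ R) (hu : 0 ≤ u) :
    -(clamp R (u + w)) ^ 3 + clamp R (u + w) ≤ u + |w| + |w| ^ 3 := by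
  rcases le_total 0 (u + w) with h | h
  · obtain ⟨h1, h2⟩ := clamp_mem_Icc_of_nonneg hR h
    have := pow_nonneg h1 3
    have := pow_nonneg (abs_nonneg w) 3
    linarith [le_abs_self w]
  · obtain ⟨h1, h2⟩ := clamp_mem_Icc_of_nonpos hR h
    have h3 : -clamp R (u + w) ≤ |w| := by linarith [neg_abs_le w]
    have h4 := pow_le_pow_left₀ (by linarith) h3 3
    have h5 : (-clamp R (u + w)) ^ 3 = -(clamp R (u + w)) ^ 3 := by ring
    linarith [abs_nonneg w]

theorem le_drift_clamp {R u w : ℝ} (hR : 0 ≤ R) (hu : u ≤ 0) :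
    u - |w| - |w| ^ 3 ≤ -(clamp R (u + w)) ^ 3 + clamp R (u + w) := by
  rcases le_total 0 (u + w) with h | h
  · obtain ⟨h1, h2⟩ := clamp_mem_Icc_of_nonneg hR h
    have h3 : clamp R (u + w) ≤ |w| := by linarith [le_abs_self w]
    have h4 := pow_le_pow_left₀ h1 h3 3
    linarith [abs_nonneg w]
  · obtain ⟨h1, h2⟩ := clamp_mem_Icc_of_nonpos hR h
    have := pow_nonneg (neg_nonneg.2 h2) 3
    have h5 : (-clamp R (u + w)) ^ 3 = -(clamp R (u + w)) ^ 3 := by ring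
    have := pow_nonneg (abs_nonneg w) 3
    linarith [neg_abs_le w]

theorem Solves.abs_sub_le_growthBound {x₀ : ℝ} {w m x : C(ℝ, ℝ)} (hx : Solves x₀ w m x) {t : ℝ}
    (ht : 0 ≤ t) : |x t - w t| ≤ growthBound x₀ w m t := by
  have hu : ∀ s, 0 ≤ s →
      x₀ + (∫ s in (0 : ℝ)..s, (-(x s) ^ 3 + x s - m s)) = x s - w s := fun s hs => by
    rw [hx s hs]; ring
  have := abs_le_growthBound (x₀ := x₀) (w := w) (m := m)
    (u := fun t => x₀ + ∫ s in (0 : ℝ)..t, (-(x s) ^ 3 + x s - m s))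
    (F := fun t => -(x t) ^ 3 + x t) (by simp)
    (fun t => hasDerivAt_const_add_integral x₀ (by fun_prop) t)
    (fun s hs h => by
      rw [hu s hs] at h ⊢
      -- At level `|x s|` the truncation is inactive, so the bound for the truncated drift is one
      -- for the true drift.
      have := drift_clamp_le (w := w s) (abs_nonneg (x s)) h
      rwa [sub_add_cancel, clamp_of_abs_le le_rfl] at this)
    (fun s hs h => by
      rw [hu s hs] at h ⊢
      have := le_drift_clamp (w := w s) (abs_nonneg (x s)) h
      rwa [sub_add_cancel, clamp_of_abs_le le_rfl] at this) ht
  rwa [hu t ht] at this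

theorem abs_drift_sub_drift_le {R a b : ℝ} (ha : |a| ≤ R) (hb : |b| ≤ R) :
    |(-a ^ 3 + a) - (-b ^ 3 + b)| ≤ (1 + 3 * R ^ 2) * |a - b| := by
  have h : (-a ^ 3 + a) - (-b ^ 3 + b) = (1 - (a ^ 2 + a * b + b ^ 2)) * (a - b) := by ring
  rw [h, abs_mul]
  refine mul_le_mul_of_nonneg_right ?_ (abs_nonneg _)
  rw [abs_le] at ha hb
  rw [abs_le]
  constructor
  · nlinarith
  · nlinarith [sq_nonneg (a + b), sq_nonneg R]

theorem exists_solves (x₀ : ℝ) (w m : C(ℝ, ℝ)) : ∃ x, Solves x₀ w m x := by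
  -- The truncation level is the a priori bound for `|u + w|`. The truncated drift is Lipschitz on
  -- bounded time intervals, and its solution never exceeds the level, so it solves the original
  -- equation.
  let R : ℝ → ℝ := fun t => growthBound x₀ w m t + |w t|
  have hR : Continuous R := by
    have := continuous_growthBound x₀ w m
    fun_prop
  have hR0 : ∀ t, 0 ≤ t → 0 ≤ R t := fun t ht =>
    add_nonneg (growthBound_nonneg x₀ w m ht) (abs_nonneg _)
  let f : C(ℝ, ℝ) → ℝ → ℝ := fun u s =>
    -(clamp (R s) (u s + w s)) ^ 3 + clamp (R s) (u s + w s)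
  have hf : ∀ u, Continuous (f u) := fun u => by simp only [f, clamp]; fun_prop
  have hfm : ∀ u, Continuous fun s => f u s - m s := fun u => (hf u).sub m.continuous
  let Φ : C(ℝ, ℝ) → C(ℝ, ℝ) := fun u =>
    ⟨fun t => x₀ + ∫ s in (0 : ℝ)..t, (f u s - m s), continuous_const.add
      (intervalIntegral.continuous_primitive
        (fun a b => (hfm u).intervalIntegrable a b) 0)⟩
  obtain ⟨u, hu⟩ := exists_fixedPoint_of_volterra (Φ := Φ) (by
    intro T
    obtain ⟨ρ, hρ⟩ := (isCompact_Icc (a := (0 : ℝ)) (b := T)).exists_bound_of_continuousOn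
      hR.continuousOn
    refine ⟨1 + 3 * ρ ^ 2, by positivity, fun u v t ht => ?_⟩
    simp only [Φ, ContinuousMap.coe_mk]
    rw [add_sub_add_left_eq_sub, ← intervalIntegral.integral_sub
      ((hfm u).intervalIntegrable _ _)
      ((hfm v).intervalIntegrable _ _),
      ← intervalIntegral.integral_const_mul]
    refine (intervalIntegral.abs_integral_le_integral_abs ht.1).trans ?_
    have hfu := hf u
    have hfv := hf v
    refine intervalIntegral.integral_mono_on ht.1 (Continuous.intervalIntegrable (by fun_prop) _ _)
      (Continuous.intervalIntegrable (by fun_prop) _ _) fun s hs => ?_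
    have hs' : |R s| ≤ ρ := hρ s ⟨hs.1, hs.2.trans ht.2⟩
    rw [sub_sub_sub_cancel_right]
    refine (abs_drift_sub_drift_le ((abs_clamp_le _ _).trans hs')
      ((abs_clamp_le _ _).trans hs')).trans ?_
    refine mul_le_mul_of_nonneg_left ((abs_clamp_sub_clamp_le _ _ _).trans ?_) (by positivity)
    rw [add_sub_add_right_eq_sub])
  have hu' : ∀ t, 0 ≤ t → u t = x₀ + ∫ s in (0 : ℝ)..t, (f u s - m s) := hu
  have hbound : ∀ t, 0 ≤ t → |u t| ≤ growthBound x₀ w m t := by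
    intro t ht
    rw [hu' t ht]
    refine abs_le_growthBound (w := w) (m := m) (F := f u) (by simp)
      (fun t => hasDerivAt_const_add_integral x₀ (hfm u) t)
      (fun s hs h => ?_) (fun s hs h => ?_) ht
    · rw [← hu' s hs] at h ⊢
      exact drift_clamp_le (hR0 s hs) h
    · rw [← hu' s hs] at h ⊢
      exact le_drift_clamp (hR0 s hs) h
  refine ⟨u + w, fun t ht => ?_⟩
  rw [ContinuousMap.add_apply, hu' t ht]
  congr 2
  refine intervalIntegral.integral_congr fun s hs => ?_
  rw [uIcc_of_le ht] at hs
  have : clamp (R s) (u s + w s) = u s + w s :=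
    clamp_of_abs_le ((abs_add_le _ _).trans (add_le_add_left (hbound s hs.1) _))
  simp only [f, this, ContinuousMap.add_apply]

/-- The solution of `dx = (-x³ + x - m) dt + dw`, `x(0) = x₀ + w(0)` on `[0, ∞)`. -/
noncomputable def sol (x₀ : ℝ) (w m : C(ℝ, ℝ)) : C(ℝ, ℝ) := (exists_solves x₀ w m).choose

theorem solves_sol (x₀ : ℝ) (w m : C(ℝ, ℝ)) : Solves x₀ w m (sol x₀ w m) :=
  (exists_solves x₀ w m).choose_spec

/-! ### Measurable dependence on the initial value and the noise -/

section Measurability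

/-- A map to a space of continuous functions on a compact space is measurable as soon as its
evaluations are. -/
theorem measurable_of_measurable_eval {Ω K : Type*} [MeasurableSpace Ω] [MetricSpace K]
    [CompactSpace K] [MeasurableSpace C(K, ℝ)] [BorelSpace C(K, ℝ)] {W : Ω → C(K, ℝ)}
    (hW : ∀ s, Measurable fun ω => W ω s) : Measurable W := by
  have hdist : ∀ g : C(K, ℝ), Measurable fun ω => dist (W ω) g := by
    intro g
    refine measurable_of_Iic fun r => ?_
    obtain ⟨D, hDc, hDd⟩ := TopologicalSpace.exists_countable_dense K
    rcases lt_or_ge r 0 with hr | hr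
    · have : (fun ω => dist (W ω) g) ⁻¹' Iic r = ∅ := by
        ext ω
        simpa using hr.trans_le dist_nonneg
      rw [this]
      exact MeasurableSet.empty
    -- By continuity the uniform distance is determined on a countable dense set.
    · have : (fun ω => dist (W ω) g) ⁻¹' Iic r = ⋂ s ∈ D, {ω | dist (W ω s) (g s) ≤ r} := by
        ext ω
        simp only [mem_preimage, mem_Iic, mem_iInter, mem_ofPred_eq, ContinuousMap.dist_le hr]
        refine ⟨fun h s _ => h s, fun h s => ?_⟩
        have hcl : IsClosed {s | dist (W ω s) (g s) ≤ r} :=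
          isClosed_le (by fun_prop) continuous_const
        exact hcl.closure_subset_iff.2 h (hDd s)
      rw [this]
      exact MeasurableSet.biInter hDc fun s _ =>
        measurableSet_le ((hW s).dist measurable_const) measurable_const
  have hbasis : TopologicalSpace.IsTopologicalBasis
      {s : Set C(K, ℝ) | ∃ g, ∃ r > 0, s = Metric.ball g r} := by
    refine TopologicalSpace.isTopologicalBasis_of_isOpen_of_nhds ?_ ?_
    · rintro _ ⟨g, r, _, rfl⟩
      exact Metric.isOpen_ball
    · intro g u hg hu
      obtain ⟨r, hr, h⟩ := Metric.isOpen_iff.1 hu g hg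
      exact ⟨_, ⟨g, r, hr, rfl⟩, Metric.mem_ball_self hr, h⟩
  rw [‹BorelSpace C(K, ℝ)›.measurable_eq, hbasis.borel_eq_generateFrom]
  refine measurable_generateFrom ?_
  rintro _ ⟨g, r, _, rfl⟩
  exact measurableSet_lt (hdist g) measurable_const

/-- The solution at time `t` depends measurably on the initial value and the noise up to time
`t`. -/
theorem measurable_sol {Ω : Type*} [MeasurableSpace Ω] {ξ : Ω → ℝ} (hξ : Measurable ξ)
    {W : Ω → C(ℝ, ℝ)} {t : ℝ} (ht : 0 ≤ t) (hW : ∀ s ∈ Icc 0 t, Measurable fun ω => W ω s)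
    (m : C(ℝ, ℝ)) : Measurable fun ω => sol (ξ ω) (W ω) m t := by
  borelize C(Icc 0 t, ℝ)
  let ext : C(Icc 0 t, ℝ) → C(ℝ, ℝ) := fun g => g.comp ⟨projIcc 0 t ht, continuous_projIcc⟩
  have hext : ∀ g (s) (hs : s ∈ Icc 0 t), ext g s = g ⟨s, hs⟩ := fun g s hs => by
    simp [ext, projIcc_of_mem ht hs]
  let G : ℝ × C(Icc 0 t, ℝ) → ℝ := fun p => sol p.1 (ext p.2) m t
  have hG : Continuous G := by
    rw [continuous_iff_continuousAt]
    rintro ⟨a, g⟩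
    rw [ContinuousAt, tendsto_iff_dist_tendsto_zero]
    let H : ℝ → ℝ := fun δ => Real.exp t * (δ + δ + t * δ) + δ
    have hH : Continuous H := by fun_prop
    have hsmall : ∀ (p : ℝ × C(Icc 0 t, ℝ)) (δ : ℝ), dist p (a, g) < δ →
        dist (G p) (G (a, g)) ≤ H δ := by
      intro p δ hp
      obtain ⟨h1, h2⟩ := max_lt_iff.1 (Prod.dist_eq (x := p) ▸ hp)
      have := (solves_sol p.1 (ext p.2) m).abs_sub_le (solves_sol a (ext g) m) (T := t) (ε := δ)
        (fun s hs => by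
          rw [hext _ s hs, hext _ s hs]
          exact (ContinuousMap.dist_apply_le_dist (f := p.2) (g := g) ⟨s, hs⟩).trans_lt h2) t ⟨ht, le_rfl⟩
      refine this.trans ?_
      have h1' : |p.1 - a| ≤ δ := h1.le
      simp only [sub_self, abs_zero, zero_add, intervalIntegral.integral_const, sub_zero,
        smul_eq_mul, H]
      gcongr
    -- Stability requires a radius strictly above the distance. The radius `2 * dist + η` qualifies
    -- for every `η > 0`, even at distance `0`, and then `η` tends to `0`.
    have hlim : Tendsto (fun p => H (2 * dist p (a, g) + 0)) (nhds (a, g)) (nhds 0) := by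
      have : Continuous fun p => H (2 * dist p (a, g) + 0) := by fun_prop
      simpa [H] using this.tendsto (a, g)
    refine squeeze_zero (fun _ => dist_nonneg) (fun p => ?_) hlim
    have hright : Tendsto (fun η : ℝ => H (2 * dist p (a, g) + η)) (nhdsWithin 0 (Ioi 0))
        (nhds (H (2 * dist p (a, g) + 0))) :=
      ((hH.comp (continuous_const.add continuous_id)).tendsto 0).mono_left nhdsWithin_le_nhds
    refine ge_of_tendsto hright (eventually_nhdsWithin_of_forall fun η hη => ?_)
    exact hsmall p _ (by linarith [mem_Ioi.1 hη, dist_nonneg (x := p) (y := (a, g))])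
  have heq : (fun ω => sol (ξ ω) (W ω) m t) =
      fun ω => G (ξ ω, (W ω).restrict (Icc 0 t)) := by
    ext ω
    exact (solves_sol _ _ _).eq_of_eqOn (solves_sol _ _ _) ht
      (fun s hs => by rw [hext _ s hs]; rfl) fun _ _ => rfl
  rw [heq]
  exact hG.measurable.comp (hξ.prodMk (measurable_of_measurable_eval fun s => hW s s.2))

end Measurability

/-! ### Cubic inequalities and integration lemmas -/

/-- This is Jensen's inequality for the cube, obtained by integrating its tangent line at the mean
`I / T`. -/
theorem integral_pow_three_le {g : ℝ → ℝ} (hg : Continuous g) (hg0 : ∀ s, 0 ≤ g s) {T : ℝ}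
    (hT : 0 ≤ T) : (∫ s in (0 : ℝ)..T, g s) ^ 3 ≤ T ^ 2 * ∫ s in (0 : ℝ)..T, g s ^ 3 := by
  rcases hT.eq_or_lt with rfl | hT
  · simp
  set I := ∫ s in (0 : ℝ)..T, g s with hI
  have hI0 : 0 ≤ I := intervalIntegral.integral_nonneg hT.le fun s _ => hg0 s
  have h : ∫ s in (0 : ℝ)..T, (3 * (I / T) ^ 2 * g s - 2 * (I / T) ^ 3) ≤
      ∫ s in (0 : ℝ)..T, g s ^ 3 := by
    refine intervalIntegral.integral_mono_on hT.le
      (Continuous.intervalIntegrable (by fun_prop) _ _)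
      (Continuous.intervalIntegrable (by fun_prop) _ _) fun s _ => ?_
    have h1 : 0 ≤ I / T := by positivity
    nlinarith [mul_nonneg (sq_nonneg (g s - I / T)) (add_nonneg (hg0 s) (mul_nonneg zero_le_two h1))]
  rw [intervalIntegral.integral_sub (Continuous.intervalIntegrable (by fun_prop) _ _)
    (Continuous.intervalIntegrable (by fun_prop) _ _), intervalIntegral.integral_const_mul,
    ← hI, intervalIntegral.integral_const, smul_eq_mul, sub_zero] at h
  calc I ^ 3 = T ^ 2 * (3 * (I / T) ^ 2 * I - T * (2 * (I / T) ^ 3)) := by field_simp; ring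
    _ ≤ _ := mul_le_mul_of_nonneg_left h (by positivity)

theorem add_pow_three_le {a b : ℝ} (ha : 0 ≤ a) (hb : 0 ≤ b) :
    (a + b) ^ 3 ≤ 4 * (a ^ 3 + b ^ 3) := by
  nlinarith [mul_nonneg (add_nonneg ha hb) (sq_nonneg (a - b))]

theorem abs_le_one_add_abs_pow_three (a : ℝ) : |a| ≤ 1 + |a| ^ 3 := by
  have := abs_nonneg a
  nlinarith [mul_nonneg this (sq_nonneg (|a| - 1)), sq_nonneg (|a| - 1)]

section Integration

variable {Ω : Type*} [MeasurableSpace Ω] {P : Measure Ω}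

/-- Dominated convergence with a fixed integrable bound plus a bound vanishing in mean. -/
theorem tendsto_integral_zero_of_abs_le_add {ι : Type*} {l : Filter ι} [l.IsCountablyGenerated]
    {f h : ι → Ω → ℝ} {D : Ω → ℝ} (hf : ∀ i, AEStronglyMeasurable (f i) P)
    (hh : ∀ i, Integrable (h i) P) (hD : Integrable D P) (hh0 : ∀ i ω, 0 ≤ h i ω)
    (hD0 : ∀ ω, 0 ≤ D ω)
    (hle : ∀ᶠ i in l, ∀ ω, |f i ω| ≤ h i ω + D ω)
    (hlim : ∀ ω, Tendsto (fun i => f i ω) l (nhds 0))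
    (hhlim : Tendsto (fun i => ∫ ω, h i ω ∂P) l (nhds 0)) :
    Tendsto (fun i => ∫ ω, f i ω ∂P) l (nhds 0) := by
  have hmeas : ∀ i, AEStronglyMeasurable (fun ω => min |f i ω| (D ω)) P := fun i =>
    (continuous_abs.comp_aestronglyMeasurable (hf i)).inf hD.aestronglyMeasurable
  have hbd : ∀ i ω, ‖min |f i ω| (D ω)‖ ≤ D ω := fun i ω => by
    rw [Real.norm_of_nonneg (le_min (abs_nonneg _) (hD0 ω))]
    exact min_le_right _ _
  have h1 : Tendsto (fun i => ∫ ω, min |f i ω| (D ω) ∂P) l (nhds 0) := by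
    have := tendsto_integral_filter_of_dominated_convergence (l := l) (μ := P)
      (F := fun i ω => min |f i ω| (D ω)) (f := fun _ => 0) D
      (Eventually.of_forall hmeas) (Eventually.of_forall fun i => ae_of_all _ (hbd i)) hD
      (ae_of_all _ fun ω => by
        refine squeeze_zero (fun i => le_min (abs_nonneg _) (hD0 ω)) (fun i => min_le_left _ _) ?_
        simpa using (hlim ω).abs)
    simpa using this
  have h2 := h1.add hhlim
  rw [add_zero] at h2
  refine squeeze_zero_norm' ?_ h2
  filter_upwards [hle] with i hi
  have hint : Integrable (fun ω => min |f i ω| (D ω)) P :=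
    hD.mono' (hmeas i) (ae_of_all _ (hbd i))
  rw [← integral_add hint (hh i)]
  refine norm_integral_le_of_norm_le (hint.add (hh i)) (ae_of_all _ fun ω => ?_)
  rw [Real.norm_eq_abs]
  rcases le_total |f i ω| (D ω) with h | h
  · simp only [min_eq_left h]
    linarith [hh0 i ω]
  · simp only [min_eq_right h]
    linarith [hi ω]

theorem integrable_uncurry_of_bounded_moment [SFinite P] {h : ℝ → Ω → ℝ}
    (hmeas : Measurable (Function.uncurry h)) {T C : ℝ}
    (hint : ∀ s ∈ Icc 0 T, Integrable (h s) P) (hC : ∀ s ∈ Icc 0 T, ∫ ω, |h s ω| ∂P ≤ C) :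
    Integrable (Function.uncurry h) ((volume.restrict (Ioc 0 T)).prod P) := by
  have hsm : AEStronglyMeasurable (Function.uncurry h) ((volume.restrict (Ioc 0 T)).prod P) :=
    hmeas.aestronglyMeasurable
  rw [integrable_prod_iff hsm]
  refine ⟨(ae_restrict_iff' measurableSet_Ioc).2 (ae_of_all _ fun s hs => hint s ⟨hs.1.le, hs.2⟩),
    ?_⟩
  refine Integrable.of_bound hsm.norm.integral_prod_right' C ?_
  refine (ae_restrict_iff' measurableSet_Ioc).2 (ae_of_all _ fun s hs => ?_)
  rw [Real.norm_of_nonneg (integral_nonneg fun _ => norm_nonneg _)]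
  exact hC s ⟨hs.1.le, hs.2⟩

end Integration

/-! ### Moments of the solution process -/

/-- A measurable family of continuous paths starting at `0` whose increments satisfy the moment
bounds of a Brownian motion. -/
structure IsNoise {Ω : Type*} [MeasurableSpace Ω] (P : Measure Ω) (W : Ω → C(ℝ, ℝ)) : Prop where
  measurable : ∀ s, Measurable fun ω => W ω s
  zero : ∀ ω, W ω 0 = 0
  moment : ∀ n : ℕ, ∃ c, ∀ s t, 0 ≤ s → 0 ≤ t →
    Integrable (fun ω => |W ω s - W ω t| ^ n) P ∧
      ∫ ω, |W ω s - W ω t| ^ n ∂P ≤ c * √|s - t| ^ n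

section Paths

variable {Ω : Type*} {ξ : Ω → ℝ} {W : Ω → C(ℝ, ℝ)}

/-- The solution with random initial value and noise, stopped at time `0` for negative times. -/
noncomputable def process (ξ : Ω → ℝ) (W : Ω → C(ℝ, ℝ)) (m : C(ℝ, ℝ)) (t : ℝ) (ω : Ω) : ℝ :=
  sol (ξ ω) (W ω) m (max t 0)

theorem continuous_process (m : C(ℝ, ℝ)) (ω : Ω) : Continuous fun t => process ξ W m t ω := by
  unfold process
  fun_prop

/-- The noise enters at the single time `max t 0` and through time integrals, so no maximal
inequality for the noise is needed. -/
theorem abs_process_pow_three_le (m : C(ℝ, ℝ)) {t T : ℝ} (ht : max t 0 ≤ T) (ω : Ω) :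
    |process ξ W m t ω| ^ 3 ≤
      4 * (growthBound (ξ ω) (W ω) m T ^ 3 + |W ω (max t 0)| ^ 3) := by
  have h0 : 0 ≤ max t 0 := le_max_right _ _
  have h1 : |process ξ W m t ω| ≤ growthBound (ξ ω) (W ω) m T + |W ω (max t 0)| := by
    have h2 := (solves_sol (ξ ω) (W ω) m).abs_sub_le_growthBound h0
    have h3 := growthBound_mono (ξ ω) (W ω) m h0 ht
    have h4 := abs_sub_abs_le_abs_sub (sol (ξ ω) (W ω) m (max t 0)) (W ω (max t 0))
    unfold process
    linarith
  exact (pow_le_pow_left₀ (abs_nonneg _) h1 3).trans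
    (add_pow_three_le (growthBound_nonneg _ _ _ (h0.trans ht)) (abs_nonneg _))

end Paths

section SolutionProcess

variable {Ω : Type*} [MeasurableSpace Ω] {P : Measure Ω}
  {ξ : Ω → ℝ} {W : Ω → C(ℝ, ℝ)}

namespace IsNoise

theorem integrable_abs_pow (hW : IsNoise P W) (n : ℕ) {t : ℝ} (ht : 0 ≤ t) :
    Integrable (fun ω => |W ω t| ^ n) P := by
  obtain ⟨c, hc⟩ := hW.moment n
  simpa [hW.zero] using (hc t 0 ht le_rfl).1

theorem exists_moment_le (hW : IsNoise P W) (n : ℕ) (T : ℝ) :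
    ∃ C, ∀ t ∈ Icc 0 T, ∫ ω, |W ω t| ^ n ∂P ≤ C := by
  obtain ⟨c, hc⟩ := hW.moment n
  refine ⟨|c| * √|T| ^ n, fun t ht => ?_⟩
  have := (hc t 0 ht.1 le_rfl).2
  simp only [hW.zero, sub_zero] at this
  refine this.trans ?_
  have h1 : |t| ≤ |T| := abs_le_abs_of_nonneg ht.1 ht.2
  have h2 : c ≤ |c| := le_abs_self c
  gcongr

theorem measurable_uncurry (hW : IsNoise P W) : Measurable (Function.uncurry fun s ω => W ω s) :=
  measurable_uncurry_of_continuous_of_measurable (fun ω => (W ω).continuous) hW.measurable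

end IsNoise

theorem measurable_uncurry_forcing (hW : IsNoise P W) (m : C(ℝ, ℝ)) :
    Measurable (Function.uncurry fun s ω => |W ω s| ^ 3 + |W ω s| + |m s| + 1) := by
  have h1 : Measurable fun p : ℝ × Ω => |W p.2 p.1| := hW.measurable_uncurry.norm
  have h2 : Measurable fun p : ℝ × Ω => |m p.1| := by fun_prop
  exact (((h1.pow_const 3).add h1).add h2).add_const 1

theorem measurable_process (hξm : Measurable ξ) (hW : IsNoise P W) (m : C(ℝ, ℝ)) (t : ℝ) :
    Measurable (process ξ W m t) :=
  measurable_sol hξm (le_max_right _ _) (fun s _ => hW.measurable s) m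

theorem measurable_uncurry_process (hξm : Measurable ξ) (hW : IsNoise P W) (m : C(ℝ, ℝ)) :
    Measurable (Function.uncurry (process ξ W m)) :=
  measurable_uncurry_of_continuous_of_measurable (continuous_process m) (measurable_process hξm hW m)

theorem measurable_growthBound (hξm : Measurable ξ) (hW : IsNoise P W) (m : C(ℝ, ℝ)) {T : ℝ}
    (hT : 0 ≤ T) : Measurable fun ω => growthBound (ξ ω) (W ω) m T := by
  have hg := measurable_uncurry_forcing hW m
  have h := (hg.comp measurable_swap).stronglyMeasurable.integral_prod_right'
    (ν := volume.restrict (Ioc 0 T))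
  simp_rw [growthBound, intervalIntegral.integral_of_le hT]
  exact ((hξm.norm).add h.measurable).const_mul _

section Moments

variable [IsProbabilityMeasure P]

/-- The forcing already contains `|W|³`, so its cube calls for the ninth moment of the noise,
uniformly on `[0, T]`. -/
theorem integrable_integral_forcing_pow_three (hW : IsNoise P W) (m : C(ℝ, ℝ)) {T : ℝ}
    (hT : 0 ≤ T) : Integrable
      (fun ω => ∫ s in (0 : ℝ)..T, (|W ω s| ^ 3 + |W ω s| + |m s| + 1) ^ 3) P := by
  have hg := measurable_uncurry_forcing hW m
  have hg0 : ∀ s ω, 0 ≤ |W ω s| ^ 3 + |W ω s| + |m s| + 1 := fun s ω => by positivity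
  obtain ⟨M, hM⟩ := (isCompact_Icc (a := (0 : ℝ)) (b := T)).exists_bound_of_continuousOn
    m.continuous.continuousOn
  have hM0 : 0 ≤ M := (norm_nonneg _).trans (hM 0 ⟨le_rfl, hT⟩)
  have hle1 : ∀ s ∈ Icc 0 T, ∀ ω, |W ω s| ^ 3 + |W ω s| + |m s| + 1 ≤
      2 * |W ω s| ^ 3 + (M + 2) := fun s hs ω => by
    have := hM s hs
    rw [Real.norm_eq_abs] at this
    linarith [abs_le_one_add_abs_pow_three (W ω s)]
  generalize hgdef : (fun (s : ℝ) (ω : Ω) => |W ω s| ^ 3 + |W ω s| + |m s| + 1) = g at hg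
  have hgs : ∀ s ω, |W ω s| ^ 3 + |W ω s| + |m s| + 1 = g s ω := fun s ω => by rw [← hgdef]
  simp only [hgs] at hg0 hle1 ⊢
  have hle : ∀ s ∈ Icc 0 T, ∀ ω, g s ω ^ 3 ≤ 32 * |W ω s| ^ 9 + 4 * (M + 2) ^ 3 := by
    intro s hs ω
    calc g s ω ^ 3 ≤ (2 * |W ω s| ^ 3 + (M + 2)) ^ 3 :=
          pow_le_pow_left₀ (hg0 s ω) (hle1 s hs ω) 3
      _ ≤ 4 * ((2 * |W ω s| ^ 3) ^ 3 + (M + 2) ^ 3) :=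
        add_pow_three_le (by positivity) (by positivity)
      _ = _ := by ring
  obtain ⟨C, hC⟩ := hW.exists_moment_le 9 T
  have hW9 : ∀ s ∈ Icc 0 T, Integrable (fun ω => 32 * |W ω s| ^ 9) P :=
    fun s hs => (hW.integrable_abs_pow 9 hs.1).const_mul 32
  have hdom : ∀ s ∈ Icc 0 T, Integrable (fun ω => 32 * |W ω s| ^ 9 + 4 * (M + 2) ^ 3) P :=
    fun s hs => (hW9 s hs).add (integrable_const _)
  have hg3 : Measurable (Function.uncurry fun s ω => g s ω ^ 3) := hg.pow_const 3
  have hint : ∀ s ∈ Icc 0 T, Integrable (fun ω => g s ω ^ 3) P := fun s hs =>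
    (hdom s hs).mono' (hg3.of_uncurry_left (x := s)).aestronglyMeasurable (ae_of_all _ fun ω => by
      rw [Real.norm_of_nonneg (pow_nonneg (hg0 s ω) 3)]
      exact hle s hs ω)
  have hprod := integrable_uncurry_of_bounded_moment (P := P) (T := T) hg3
    (C := 32 * C + 4 * (M + 2) ^ 3) hint
    (fun s hs => by
      have h1 : ∀ ω, |g s ω ^ 3| = g s ω ^ 3 := fun ω => abs_of_nonneg (pow_nonneg (hg0 s ω) 3)
      simp_rw [h1]
      refine (integral_mono (hint s hs) (hdom s hs) (hle s hs)).trans ?_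
      rw [integral_add (hW9 s hs) (integrable_const _), integral_const_mul, integral_const]
      have := hC s hs
      simp only [probReal_univ, one_smul]
      linarith)
  simp_rw [intervalIntegral.integral_of_le hT]
  exact hprod.integral_prod_right

theorem integrable_growthBound_pow_three (hξm : Measurable ξ)
    (hξ : Integrable (fun ω => |ξ ω| ^ 3) P) (hW : IsNoise P W) (m : C(ℝ, ℝ)) {T : ℝ}
    (hT : 0 ≤ T) : Integrable (fun ω => growthBound (ξ ω) (W ω) m T ^ 3) P := by
  refine (((hξ.add ((integrable_integral_forcing_pow_three hW m hT).const_mul (T ^ 2))).const_mul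
    4).const_mul (Real.exp T ^ 3)).mono'
    ((measurable_growthBound hξm hW m hT).pow_const 3).aestronglyMeasurable
    (ae_of_all _ fun ω => ?_)
  rw [Real.norm_of_nonneg (pow_nonneg (growthBound_nonneg _ _ _ hT) 3), growthBound, mul_pow]
  refine mul_le_mul_of_nonneg_left ((add_pow_three_le (abs_nonneg _)
    (intervalIntegral.integral_nonneg hT fun s _ => by positivity)).trans ?_) (by positivity)
  refine mul_le_mul_of_nonneg_left (add_le_add_right ?_ _) (by norm_num)
  exact integral_pow_three_le (by fun_prop) (fun s => by positivity) hT

theorem integrable_abs_process_pow_three (hξm : Measurable ξ)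
    (hξ : Integrable (fun ω => |ξ ω| ^ 3) P) (hW : IsNoise P W) (m : C(ℝ, ℝ)) (t : ℝ) :
    Integrable (fun ω => |process ξ W m t ω| ^ 3) P := by
  have h0 : 0 ≤ max t 0 := le_max_right _ _
  refine (((integrable_growthBound_pow_three hξm hξ hW m h0).add
    (hW.integrable_abs_pow 3 h0)).const_mul 4).mono'
    ((measurable_process hξm hW m t).norm.pow_const 3).aestronglyMeasurable
    (ae_of_all _ fun ω => ?_)
  rw [Real.norm_of_nonneg (by positivity)]
  exact abs_process_pow_three_le m le_rfl ω

theorem integrable_process (hξm : Measurable ξ)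
    (hξ : Integrable (fun ω => |ξ ω| ^ 3) P) (hW : IsNoise P W) (m : C(ℝ, ℝ)) (t : ℝ) :
    Integrable (process ξ W m t) P := by
  refine ((integrable_const 1).add (integrable_abs_process_pow_three hξm hξ hW m t)).mono'
    (measurable_process hξm hW m t).aestronglyMeasurable
    (ae_of_all _ fun ω => abs_le_one_add_abs_pow_three _)

theorem integrable_process_pow_three_sub (hξm : Measurable ξ)
    (hξ : Integrable (fun ω => |ξ ω| ^ 3) P) (hW : IsNoise P W) (m : C(ℝ, ℝ)) (t : ℝ) :
    Integrable (fun ω => process ξ W m t ω ^ 3 - process ξ W m t ω) P := by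
  refine Integrable.sub ?_ (integrable_process hξm hξ hW m t)
  refine (integrable_abs_process_pow_three hξm hξ hW m t).mono'
    ((measurable_process hξm hW m t).pow_const 3).aestronglyMeasurable
    (ae_of_all _ fun ω => ?_)
  rw [norm_pow, Real.norm_eq_abs]

theorem abs_pow_three_sub_le (x : ℝ) : |x ^ 3 - x| ≤ 2 * |x| ^ 3 + 1 := by
  have h1 := abs_sub (x ^ 3) x
  rw [abs_pow] at h1
  linarith [abs_le_one_add_abs_pow_three x]

/-- The bound for the cube at time `s` contains `|W s|³`, which moves with `s`. It splits into a
fixed integrable part at time `t` and an increment whose third moment tends to `0`. -/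
theorem continuous_integral_process_pow_three_sub (hξm : Measurable ξ)
    (hξ : Integrable (fun ω => |ξ ω| ^ 3) P) (hW : IsNoise P W) (m : C(ℝ, ℝ)) :
    Continuous fun t => ∫ ω, (process ξ W m t ω ^ 3 - process ξ W m t ω) ∂P := by
  rw [continuous_iff_continuousAt]
  intro t
  rw [ContinuousAt, tendsto_iff_norm_sub_tendsto_zero]
  obtain ⟨c, hc⟩ := hW.moment 3
  have hT : 0 ≤ max (t + 1) 0 := le_max_right _ _
  have h0 : ∀ s : ℝ, 0 ≤ max s 0 := fun s => le_max_right _ _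
  have key := tendsto_integral_zero_of_abs_le_add (P := P) (l := nhds t)
    (f := fun s ω => (process ξ W m s ω ^ 3 - process ξ W m s ω) -
      (process ξ W m t ω ^ 3 - process ξ W m t ω))
    (h := fun s ω => 32 * |W ω (max s 0) - W ω (max t 0)| ^ 3)
    (D := fun ω => (8 * growthBound (ξ ω) (W ω) m (max (t + 1) 0) ^ 3 +
      32 * |W ω (max t 0)| ^ 3) + (2 * |process ξ W m t ω| ^ 3 + 2))
    (fun s => ((integrable_process_pow_three_sub hξm hξ hW m s).sub
      (integrable_process_pow_three_sub hξm hξ hW m t)).aestronglyMeasurable)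
    (fun s => (hc _ _ (h0 s) (h0 t)).1.const_mul _)
    ((((integrable_growthBound_pow_three hξm hξ hW m hT).const_mul 8).add
      ((hW.integrable_abs_pow 3 (h0 t)).const_mul 32)).add
      (((integrable_abs_process_pow_three hξm hξ hW m t).const_mul 2).add (integrable_const 2)))
    (fun s ω => by positivity)
    (fun ω => by
      have := growthBound_nonneg (ξ ω) (W ω) m hT
      positivity)
    (by
      filter_upwards [Iio_mem_nhds (show t < t + 1 by linarith)] with s hs ω
      have h1 := abs_process_pow_three_le (ξ := ξ) (W := W) m
        (max_le_max_right 0 (mem_Iio.1 hs).le) ω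
      have h2 := abs_pow_three_sub_le (process ξ W m s ω)
      have h3 := abs_pow_three_sub_le (process ξ W m t ω)
      have h4 : |W ω (max s 0)| ^ 3 ≤
          4 * (|W ω (max s 0) - W ω (max t 0)| ^ 3 + |W ω (max t 0)| ^ 3) := by
        refine (pow_le_pow_left₀ (abs_nonneg _) ?_ 3).trans
          (add_pow_three_le (abs_nonneg _) (abs_nonneg _))
        linarith [abs_sub_abs_le_abs_sub (W ω (max s 0)) (W ω (max t 0))]
      have h5 := abs_sub (process ξ W m s ω ^ 3 - process ξ W m s ω)
        (process ξ W m t ω ^ 3 - process ξ W m t ω)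
      linarith)
    (fun ω => by
      have hX := continuous_process (ξ := ξ) (W := W) m ω
      have : Continuous fun s => (process ξ W m s ω ^ 3 - process ξ W m s ω) -
        (process ξ W m t ω ^ 3 - process ξ W m t ω) := by fun_prop
      simpa using this.tendsto t)
    (by
      have hlim : Tendsto (fun s : ℝ => 32 * (c * √|max s 0 - max t 0| ^ 3)) (nhds t)
          (nhds 0) := by
        have : Continuous fun s : ℝ => 32 * (c * √|max s 0 - max t 0| ^ 3) := by fun_prop
        simpa using this.tendsto t
      refine squeeze_zero (fun s => integral_nonneg fun ω => by positivity) (fun s => ?_) hlim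
      rw [integral_const_mul]
      exact mul_le_mul_of_nonneg_left (hc _ _ (h0 s) (h0 t)).2 (by norm_num))
  have := key.norm
  rw [norm_zero] at this
  refine this.congr fun s => ?_
  rw [integral_sub (integrable_process_pow_three_sub hξm hξ hW m s)
    (integrable_process_pow_three_sub hξm hξ hW m t)]

theorem exists_integral_abs_process_le (hξm : Measurable ξ)
    (hξ : Integrable (fun ω => |ξ ω| ^ 3) P) (hW : IsNoise P W) (m : C(ℝ, ℝ)) (T : ℝ) :
    ∃ C, ∀ t ∈ Icc 0 T, ∫ ω, |process ξ W m t ω ^ 3 - process ξ W m t ω| ∂P ≤ C := by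
  rcases lt_or_ge T 0 with hT | hT
  · exact ⟨0, fun t ht => absurd (ht.1.trans ht.2) (not_le.2 hT)⟩
  obtain ⟨C, hC⟩ := hW.exists_moment_le 3 T
  have hU := integrable_growthBound_pow_three hξm hξ hW m hT
  refine ⟨8 * ((∫ ω, growthBound (ξ ω) (W ω) m T ^ 3 ∂P) + C) + 1, fun t ht => ?_⟩
  have hWt := hW.integrable_abs_pow 3 ht.1
  have hdom : Integrable (fun ω => 8 * (growthBound (ξ ω) (W ω) m T ^ 3 + |W ω t| ^ 3) + 1) P :=
    ((hU.add hWt).const_mul 8).add (integrable_const 1)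
  refine (integral_mono (integrable_process_pow_three_sub hξm hξ hW m t).abs hdom
    fun ω => ?_).trans ?_
  · have h1 := abs_process_pow_three_le (ξ := ξ) (W := W) m (max_le ht.2 hT) ω
    rw [max_eq_left ht.1] at h1
    have := abs_pow_three_sub_le (process ξ W m t ω)
    simp only
    linarith
  · have hadd : Integrable (fun ω => 8 * (growthBound (ξ ω) (W ω) m T ^ 3 + |W ω t| ^ 3)) P :=
      (hU.add hWt).const_mul 8
    rw [integral_add hadd (integrable_const 1), integral_const_mul, integral_const]
    have h2 : ∫ ω, (growthBound (ξ ω) (W ω) m T ^ 3 + |W ω t| ^ 3) ∂P =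
      (∫ ω, growthBound (ξ ω) (W ω) m T ^ 3 ∂P) + ∫ ω, |W ω t| ^ 3 ∂P := integral_add hU hWt
    rw [h2]
    have := hC t ht
    simp only [probReal_univ, one_smul]
    linarith

/-- Each path is integrated in time first, where the equation evaluates the integral; Fubini then
transfers this to expectations. -/
theorem integral_process (hξm : Measurable ξ)
    (hξ : Integrable (fun ω => |ξ ω| ^ 3) P) (hW : IsNoise P W) (m : C(ℝ, ℝ)) {t : ℝ}
    (ht : 0 ≤ t) :
    ∫ s in (0 : ℝ)..t, (∫ ω, (process ξ W m s ω ^ 3 - process ξ W m s ω) ∂P) =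
      (∫ ω, (ξ ω + W ω t) ∂P) - (∫ s in (0 : ℝ)..t, m s) - ∫ ω, process ξ W m t ω ∂P := by
  obtain ⟨C, hC⟩ := exists_integral_abs_process_le hξm hξ hW m t
  have hX := measurable_uncurry_process hξm hW m
  have hXm : Measurable (Function.uncurry fun s ω =>
      process ξ W m s ω ^ 3 - process ξ W m s ω) := (hX.pow_const 3).sub hX
  have hprod := integrable_uncurry_of_bounded_moment (P := P) (T := t) hXm
    (fun s _ => integrable_process_pow_three_sub hξm hξ hW m s) hC
  have hpath : ∀ ω, ∫ s in (0 : ℝ)..t, (process ξ W m s ω ^ 3 - process ξ W m s ω) =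
      (ξ ω + W ω t) - (∫ s in (0 : ℝ)..t, m s) - process ξ W m t ω := by
    intro ω
    have hXc := continuous_process (ξ := ξ) (W := W) m ω
    have h1 : process ξ W m t ω = ξ ω +
        (∫ s in (0 : ℝ)..t, (-(process ξ W m s ω ^ 3 - process ξ W m s ω) - m s)) + W ω t := by
      have := solves_sol (ξ ω) (W ω) m t ht
      rw [process, max_eq_left ht, this]
      congr 2
      refine intervalIntegral.integral_congr fun s hs => ?_
      rw [uIcc_of_le ht] at hs
      simp only [process, max_eq_left hs.1]
      ring
    rw [intervalIntegral.integral_sub (Continuous.intervalIntegrable (by fun_prop) _ _)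
      (Continuous.intervalIntegrable (by fun_prop) _ _), intervalIntegral.integral_neg] at h1
    linarith
  have hWi : Integrable (fun ω => W ω t) P := by
    refine (integrable_norm_iff (hW.measurable t).aestronglyMeasurable).1 ?_
    simpa using hW.integrable_abs_pow 1 ht
  have hξi : Integrable ξ P :=
    ((integrable_const 1).add hξ).mono' hξm.aestronglyMeasurable
      (ae_of_all _ fun ω => abs_le_one_add_abs_pow_three _)
  have hsum : Integrable (fun ω => ξ ω + W ω t) P := hξi.add hWi
  rw [intervalIntegral.integral_of_le ht, integral_integral_swap hprod]
  simp_rw [← intervalIntegral.integral_of_le ht, hpath]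
  have hsub : Integrable (fun ω => ξ ω + W ω t - ∫ s in (0 : ℝ)..t, m s) P :=
    hsum.sub (integrable_const _)
  rw [integral_sub hsub (integrable_process hξm hξ hW m t),
    integral_sub hsum (integrable_const _), integral_const, probReal_univ, one_smul]

/-- For a given initial value and noise there is exactly one deterministic function `m` that solves
the equation for the mean field along the solution driven by `m`. -/
theorem existsUnique_meanField (hξm : Measurable ξ)
    (hξ : Integrable (fun ω => |ξ ω| ^ 3) P) (hW : IsNoise P W)
    (α θ μ₀ : ℝ) :
    ∃ m : C(ℝ, ℝ), (∀ t, 0 ≤ t → m t = μ₀ + ∫ s in (0 : ℝ)..t, (-(α - θ) * m s +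
        θ * ∫ ω, (process ξ W m s ω ^ 3 - process ξ W m s ω) ∂P)) ∧
      ∀ m' : C(ℝ, ℝ), (∀ t, 0 ≤ t → m' t = μ₀ + ∫ s in (0 : ℝ)..t, (-(α - θ) * m' s +
        θ * ∫ ω, (process ξ W m' s ω ^ 3 - process ξ W m' s ω) ∂P)) →
        ∀ t, 0 ≤ t → m' t = m t := by
  have hk := continuous_integral_process_pow_three_sub hξm hξ hW
  have hcont : ∀ m : C(ℝ, ℝ), Continuous fun s => -(α - θ) * m s +
      θ * ∫ ω, (process ξ W m s ω ^ 3 - process ξ W m s ω) ∂P := fun m => by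
    have := hk m
    fun_prop
  let Φ : C(ℝ, ℝ) → C(ℝ, ℝ) := fun m => ⟨fun t => μ₀ + ∫ s in (0 : ℝ)..t, (-(α - θ) * m s +
        θ * ∫ ω, (process ξ W m s ω ^ 3 - process ξ W m s ω) ∂P),
    continuous_const.add (intervalIntegral.continuous_primitive
      (fun a b => (hcont m).intervalIntegrable a b) 0)⟩
  -- This form of the map contains no cube: the `θ ∫ m` terms cancel and `m` enters only through `∫
  -- m` and `E x(t)`.
  have hΦ : ∀ m t, 0 ≤ t → Φ m t = μ₀ - α * (∫ s in (0 : ℝ)..t, m s) +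
      θ * ((∫ ω, (ξ ω + W ω t) ∂P) - ∫ ω, process ξ W m t ω ∂P) := by
    intro m t ht
    have := hk m
    simp only [Φ, ContinuousMap.coe_mk]
    rw [intervalIntegral.integral_add (Continuous.intervalIntegrable (by fun_prop) _ _)
      (Continuous.intervalIntegrable (by fun_prop) _ _), intervalIntegral.integral_const_mul,
      intervalIntegral.integral_const_mul, integral_process hξm hξ hW m ht]
    ring
  have hlip : ∀ T, ∃ K, 0 ≤ K ∧ ∀ m m' : C(ℝ, ℝ), ∀ t ∈ Icc 0 T,
      |Φ m t - Φ m' t| ≤ K * ∫ s in (0 : ℝ)..t, |m s - m' s| := by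
    intro T
    refine ⟨|α| + |θ| * Real.exp T, by positivity, fun m m' t ht => ?_⟩
    have hI : 0 ≤ ∫ s in (0 : ℝ)..t, |m s - m' s| :=
      intervalIntegral.integral_nonneg ht.1 fun s _ => abs_nonneg _
    have h1 : |(∫ s in (0 : ℝ)..t, m s) - ∫ s in (0 : ℝ)..t, m' s| ≤
        ∫ s in (0 : ℝ)..t, |m s - m' s| := by
      rw [← intervalIntegral.integral_sub (m.continuous.intervalIntegrable _ _)
        (m'.continuous.intervalIntegrable _ _)]
      exact intervalIntegral.abs_integral_le_integral_abs ht.1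
    have h2 : |(∫ ω, process ξ W m t ω ∂P) - ∫ ω, process ξ W m' t ω ∂P| ≤
        Real.exp T * ∫ s in (0 : ℝ)..t, |m s - m' s| := by
      rw [← integral_sub (integrable_process hξm hξ hW m t) (integrable_process hξm hξ hW m' t)]
      have := norm_integral_le_of_norm_le_const (μ := P)
        (f := fun ω => process ξ W m t ω - process ξ W m' t ω)
        (C := Real.exp t * ∫ s in (0 : ℝ)..t, |m s - m' s|) (ae_of_all _ fun ω => by
          have := (solves_sol (ξ ω) (W ω) m).abs_sub_le_of_eqOn (solves_sol (ξ ω) (W ω) m') ht.1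
            fun _ _ => rfl
          rw [sub_self, abs_zero, zero_add] at this
          simpa only [process, max_eq_left ht.1, Real.norm_eq_abs] using this)
      rw [probReal_univ, mul_one] at this
      refine this.trans (mul_le_mul_of_nonneg_right (Real.exp_le_exp.2 ht.2) hI)
    rw [hΦ m t ht.1, hΦ m' t ht.1]
    calc _ = |-(α * ((∫ s in (0 : ℝ)..t, m s) - ∫ s in (0 : ℝ)..t, m' s)) -
          θ * ((∫ ω, process ξ W m t ω ∂P) - ∫ ω, process ξ W m' t ω ∂P)| := by
          congr 1; ring
      _ ≤ |α| * |(∫ s in (0 : ℝ)..t, m s) - ∫ s in (0 : ℝ)..t, m' s| +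
          |θ| * |(∫ ω, process ξ W m t ω ∂P) - ∫ ω, process ξ W m' t ω ∂P| := by
          refine (abs_sub _ _).trans ?_
          rw [abs_neg, abs_mul, abs_mul]
      _ ≤ |α| * (∫ s in (0 : ℝ)..t, |m s - m' s|) +
          |θ| * (Real.exp T * ∫ s in (0 : ℝ)..t, |m s - m' s|) := by gcongr
      _ = _ := by ring
  obtain ⟨m, hm⟩ := exists_fixedPoint_of_volterra hlip
  exact ⟨m, hm, fun m' hm' => eqOn_of_volterra hlip hm' hm⟩

end Moments

end SolutionProcess

/-! ### Brownian motion as a noise with continuous paths -/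

theorem integrable_abs_pow_gaussianReal (v : ℝ≥0) (n : ℕ) :
    Integrable (fun x : ℝ => |x| ^ n) (gaussianReal 0 v) := by
  rcases Nat.eq_zero_or_pos n with rfl | hn
  · simp
  · exact (memLp_id_gaussianReal (n : ℝ≥0)).integrable_norm_pow (p := n) hn.ne'

theorem integral_abs_pow_gaussianReal (v : ℝ≥0) (n : ℕ) :
    ∫ x, |x| ^ n ∂(gaussianReal 0 v) = (∫ x, |x| ^ n ∂(gaussianReal 0 1)) * √v ^ n := by
  have h := gaussianReal_map_const_mul (μ := 0) (v := 1) (√v)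
  have hv : (NNReal.mk (√v ^ 2) (sq_nonneg _)) * 1 = v := by
    ext
    simp
  rw [mul_zero, hv] at h
  rw [← h, integral_map (by fun_prop) (by fun_prop)]
  simp_rw [abs_mul, mul_pow, abs_of_nonneg (Real.sqrt_nonneg _)]
  rw [integral_const_mul, mul_comm]

section Noise

variable {Ω : Type*} [MeasurableSpace Ω] {P : Measure Ω} {B : ℝ≥0 → Ω → ℝ}

theorem integrable_and_integral_abs_sub_pow (hB : IsBrownianReal B P) (n : ℕ) (s t : ℝ≥0) :
    Integrable (fun ω => |B s ω - B t ω| ^ n) P ∧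
      ∫ ω, |B s ω - B t ω| ^ n ∂P =
        (∫ x, |x| ^ n ∂(gaussianReal 0 1)) * √|(s : ℝ) - t| ^ n := by
  have hlaw := hB.hasLaw_sub s t
  have hae := hlaw.aemeasurable
  have hi := integrable_abs_pow_gaussianReal (nndist s.1 t.1) n
  constructor
  · rw [← hlaw.map_eq, integrable_map_measure (by fun_prop) hae] at hi
    exact hi
  · have := hlaw.integral_comp (f := fun x : ℝ => |x| ^ n) (by fun_prop)
    rw [integral_abs_pow_gaussianReal] at this
    exact this

/-- A Brownian motion has a version with values in the space of continuous functions. -/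
theorem exists_isNoise (hB : IsBrownianReal B P) (σ : ℝ) :
    ∃ W : Ω → C(ℝ, ℝ), IsNoise P W ∧
      ∀ᵐ ω ∂P, ∀ t : ℝ, W ω t = σ * (B t.toNNReal ω - B 0 ω) := by
  -- Measurable versions are compared only at countably many times, so a single null set suffices;
  -- path continuity recovers the other times.
  let q := TopologicalSpace.denseSeq ℝ≥0
  have hmk : ∀ᵐ ω ∂P, ∀ n, B (q n) ω = (hB.aemeasurable (q n)).mk (B (q n)) ω :=
    ae_all_iff.2 fun n => (hB.aemeasurable (q n)).ae_eq_mk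
  obtain ⟨N, hN, hNm, hNp⟩ := (hB.cont.and hmk).exists_measurable_mem
  have hind : ∀ t, Measurable (N.indicator (B t)) := by
    intro t
    obtain ⟨z, hz, hzt⟩ := mem_closure_iff_seq_limit.1 (TopologicalSpace.denseRange_denseSeq ℝ≥0 t)
    choose φ hφ using hz
    refine measurable_of_tendsto_metrizable
      (f := fun k => N.indicator ((hB.aemeasurable (q (φ k))).mk (B (q (φ k)))))
      (fun k => (hB.aemeasurable (q (φ k))).measurable_mk.indicator hNm) ?_
    rw [tendsto_pi_nhds]
    intro ω
    by_cases hω : ω ∈ N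
    · simp only [indicator_of_mem hω]
      have := ((hNp ω hω).1.tendsto t).comp hzt
      refine this.congr fun k => ?_
      rw [← (hNp ω hω).2 (φ k), Function.comp_apply, ← hφ k]
    · simp [indicator_of_notMem hω]
  classical
  let W : Ω → C(ℝ, ℝ) := fun ω =>
    if h : ω ∈ N then ⟨fun t => σ * (B t.toNNReal ω - B 0 ω), by
      have := (hNp ω h).1
      fun_prop⟩ else 0
  have hWN : ∀ ω ∈ N, ∀ t : ℝ, W ω t = σ * (B t.toNNReal ω - B 0 ω) := fun ω hω t => by
    simp [W, hω]
  have hWN' : ∀ ω ∉ N, ∀ t : ℝ, W ω t = 0 := fun ω hω t => by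
    simp [W, hω]
  have hWae : ∀ᵐ ω ∂P, ∀ t : ℝ, W ω t = σ * (B t.toNNReal ω - B 0 ω) := by
    filter_upwards [hN] with ω hω using hWN ω hω
  refine ⟨W, ⟨fun t => ?_, fun ω => ?_, fun n => ?_⟩, hWae⟩
  · have : (fun ω => W ω t) =
        fun ω => σ * (N.indicator (B t.toNNReal) ω - N.indicator (B 0) ω) := by
      ext ω
      by_cases hω : ω ∈ N
      · simp [hWN ω hω, hω]
      · simp [hWN' ω hω, hω]
    rw [this]
    exact ((hind _).sub (hind _)).const_mul σ
  · by_cases hω : ω ∈ N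
    · simp [hWN ω hω]
    · exact hWN' ω hω 0
  · refine ⟨|σ| ^ n * ∫ x, |x| ^ n ∂(gaussianReal 0 1), fun s t hs ht => ?_⟩
    have heq : (fun ω => |W ω s - W ω t| ^ n) =ᵐ[P]
        fun ω => |σ| ^ n * |B s.toNNReal ω - B t.toNNReal ω| ^ n := by
      filter_upwards [hWae] with ω hω
      rw [hω, hω, ← mul_pow, ← abs_mul]
      congr 2
      ring
    obtain ⟨h1, h2⟩ := integrable_and_integral_abs_sub_pow hB n s.toNNReal t.toNNReal
    refine ⟨(integrable_congr heq).2 (h1.const_mul _), ?_⟩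
    rw [integral_congr_ae heq, integral_const_mul, h2, Real.coe_toNNReal s hs,
      Real.coe_toNNReal t ht, mul_assoc]

end Noise

/-! ### Adaptedness and the link with solutions -/

section Adapted

variable {Ω : Type*} [mΩ : MeasurableSpace Ω] {P : Measure Ω} {ξ ξ' : Ω → ℝ} {B : ℝ≥0 → Ω → ℝ}
  {W : Ω → C(ℝ, ℝ)}

/-- Measurable dependence is applied with the augmented σ-algebra on `Ω`. The augmentation absorbs
the null sets on which `ξ'` and `W` differ from the given data. -/
theorem measurable_augmentedSigma_process (hξ : ξ' =ᵐ[P] ξ) {σ : ℝ}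
    (hWB : ∀ᵐ ω ∂P, ∀ t : ℝ, W ω t = σ * (B t.toNNReal ω - B 0 ω)) (m : C(ℝ, ℝ)) (t : ℝ≥0) :
    Measurable[augmentedSigma P ξ B t] fun ω => process ξ' W m t ω := by
  have hξin : Measurable[inputSigma ξ B t] ξ :=
    (comap_measurable ξ).mono le_sup_left le_rfl
  have hBin : ∀ s : ℝ≥0, s ≤ t → Measurable[inputSigma ξ B t] (B s) := fun s hs =>
    (comap_measurable (B s)).mono ((le_iSup (fun s : Iic t =>
      MeasurableSpace.comap (B s) inferInstance) ⟨s, hs⟩).trans le_sup_right) le_rfl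
  refine @measurable_sol Ω (augmentedSigma P ξ B t) ξ'
    (hξin.eventuallyMeasurable_of_eventuallyEq hξ) W (max (t : ℝ) 0) (le_max_right _ _)
    (fun s hs => ?_) m
  rw [max_eq_left t.coe_nonneg] at hs
  have hmeas : Measurable[inputSigma ξ B t] fun ω => σ * (B s.toNNReal ω - B 0 ω) :=
    ((hBin _ (Real.toNNReal_le_iff_le_coe.2 hs.2)).sub (hBin 0 zero_le)).const_mul σ
  refine hmeas.eventuallyMeasurable_of_eventuallyEq ?_
  filter_upwards [hWB] with ω hω using hω s

end Adapted

section Solution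

variable {Ω : Type*} [mΩ : MeasurableSpace Ω] {P : Measure Ω}
  {ξ ξ' : Ω → ℝ} {B : ℝ≥0 → Ω → ℝ} {W : Ω → C(ℝ, ℝ)} {α θ σ μ₀ : ℝ}

theorem isStrongSolution_process [IsProbabilityMeasure P] (hξ' : Measurable ξ')
    (hξ'3 : Integrable (fun ω => |ξ' ω| ^ 3) P) (hξξ' : ξ' =ᵐ[P] ξ) (hW : IsNoise P W)
    (hWB : ∀ᵐ ω ∂P, ∀ t : ℝ, W ω t = σ * (B t.toNNReal ω - B 0 ω)) {m : C(ℝ, ℝ)}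
    (hm : ∀ t, 0 ≤ t → m t = μ₀ + ∫ s in (0 : ℝ)..t, (-(α - θ) * m s +
      θ * ∫ ω, (process ξ' W m s ω ^ 3 - process ξ' W m s ω) ∂P)) :
    IsStrongSolution P α θ σ μ₀ B ξ (fun t ω => process ξ' W m t ω) m where
  aemeasurable t := (measurable_process hξ' hW m t).aemeasurable
  continuous_paths := ae_of_all _ fun ω =>
    (continuous_process m ω).comp NNReal.continuous_coe
  init_x := by
    filter_upwards [hξξ'] with ω hω
    have := solves_sol (ξ' ω) (W ω) m 0 le_rfl
    rw [intervalIntegral.integral_same, hW.zero] at this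
    simp only [process, NNReal.coe_zero, max_self, this, add_zero]
    exact hω
  init_mu := by simpa using hm 0 le_rfl
  eq_x := by
    filter_upwards [hWB] with ω hω t
    have h0 := solves_sol (ξ' ω) (W ω) m 0 le_rfl
    have ht := solves_sol (ξ' ω) (W ω) m t t.coe_nonneg
    rw [intervalIntegral.integral_same, hW.zero] at h0
    have hint : ∫ s in (0 : ℝ)..t, (-(process ξ' W m s.toNNReal ω) ^ 3 +
        process ξ' W m s.toNNReal ω - m s) = ∫ s in (0 : ℝ)..t,
          (-(sol (ξ' ω) (W ω) m s) ^ 3 + sol (ξ' ω) (W ω) m s - m s) := by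
      refine intervalIntegral.integral_congr fun s hs => ?_
      rw [uIcc_of_le t.coe_nonneg] at hs
      simp [process, max_eq_left hs.1]
    rw [hint]
    simp only [process, max_eq_left t.coe_nonneg, NNReal.coe_zero, max_self]
    rw [ht, h0, hω, Real.toNNReal_coe]
    ring
  integrable t := integrable_process_pow_three_sub hξ' hξ'3 hW m t
  eq_mu t := by
    have hk := continuous_integral_process_pow_three_sub hξ' hξ'3 hW m
    have h := hasDerivAt_const_add_integral μ₀ (f := fun s => -(α - θ) * m s +
      θ * ∫ ω, (process ξ' W m s ω ^ 3 - process ξ' W m s ω) ∂P) (by fun_prop) t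
    exact h.hasDerivWithinAt.congr (fun s hs => hm s hs) (hm t t.coe_nonneg)
  adapted t := measurable_augmentedSigma_process hξξ' hWB m t

/-- Every solution is the solution driven by its own mean-field component, which satisfies the
integrated equation for the mean field. -/
theorem IsSolution.exists_eq_process [IsProbabilityMeasure P] (hξ' : Measurable ξ')
    (hξ'3 : Integrable (fun ω => |ξ' ω| ^ 3) P) (hξξ' : ξ' =ᵐ[P] ξ) (hW : IsNoise P W)
    (hWB : ∀ᵐ ω ∂P, ∀ t : ℝ, W ω t = σ * (B t.toNNReal ω - B 0 ω))
    {y : ℝ≥0 → Ω → ℝ} {ν : ℝ → ℝ} (h : IsSolution P α θ σ μ₀ B ξ y ν) :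
    ∃ m : C(ℝ, ℝ), (∀ t, 0 ≤ t → m t = ν t) ∧
      (∀ᵐ ω ∂P, ∀ t : ℝ≥0, y t ω = process ξ' W m t ω) ∧
      ∀ t, 0 ≤ t → m t = μ₀ + ∫ s in (0 : ℝ)..t, (-(α - θ) * m s +
        θ * ∫ ω, (process ξ' W m s ω ^ 3 - process ξ' W m s ω) ∂P) := by
  have hνc : ContinuousOn ν (Ici 0) := fun t ht =>
    (h.eq_mu ⟨t, ht⟩).continuousWithinAt
  -- Values of `ν` at negative times are arbitrary, so they are replaced by `ν 0`.
  let m : C(ℝ, ℝ) := ⟨fun t => ν (max t 0),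
    hνc.comp_continuous (by fun_prop) fun t => mem_Ici.2 (le_max_right _ _)⟩
  have hmν : ∀ t, 0 ≤ t → m t = ν t := fun t ht => by simp [m, max_eq_left ht]
  have hy : ∀ᵐ ω ∂P, ∀ t : ℝ≥0, y t ω = process ξ' W m t ω := by
    filter_upwards [hWB, hξξ', h.continuous_paths, h.init_x, h.eq_x] with ω hω hξω hc hi he
    let z : C(ℝ, ℝ) := ⟨fun t => y t.toNNReal ω, hc.comp continuous_real_toNNReal⟩
    have hz : Solves (ξ' ω) (W ω) m z := by
      intro t ht
      have h1 := he t.toNNReal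
      rw [Real.coe_toNNReal t ht, hi, ← hξω] at h1
      rw [hω t]
      refine h1.trans ?_
      congr 2
      refine intervalIntegral.integral_congr fun s hs => ?_
      rw [uIcc_of_le ht] at hs
      simp [z, hmν s hs.1]
    intro t
    have := hz.eq_of_eqOn (solves_sol (ξ' ω) (W ω) m) t.coe_nonneg (fun _ _ => rfl) fun _ _ => rfl
    simpa [z, process] using this
  refine ⟨m, hmν, hy, fun t ht => ?_⟩
  have hk := continuous_integral_process_pow_three_sub hξ' hξ'3 hW m
  have hder : ∀ s ∈ Ioo 0 t, HasDerivWithinAt m (-(α - θ) * m s +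
      θ * ∫ ω, (process ξ' W m s ω ^ 3 - process ξ' W m s ω) ∂P) (Ioi s) s := by
    intro s hs
    have hs0 : 0 ≤ s := hs.1.le
    have h1 := h.eq_mu s.toNNReal
    have h2 : ∫ ω, (y s.toNNReal ω ^ 3 - y s.toNNReal ω) ∂P =
        ∫ ω, (process ξ' W m s ω ^ 3 - process ξ' W m s ω) ∂P := by
      refine integral_congr_ae ?_
      filter_upwards [hy] with ω hω
      rw [hω, Real.coe_toNNReal s hs0]
    rw [h2, Real.coe_toNNReal s hs0, ← hmν s hs0] at h1
    exact (h1.congr hmν (hmν s hs0)).mono (Ioi_subset_Ici hs0)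
  have := intervalIntegral.integral_eq_sub_of_hasDeriv_right_of_le ht m.continuous.continuousOn
    hder (Continuous.intervalIntegrable (by fun_prop) _ _)
  rw [this, hmν 0 le_rfl, h.init_mu]
  ring

end Solution

end CubicMcKeanVlasov

/-! ### Existence and uniqueness -/

theorem mainTheorem5 {Ω : Type*} [MeasurableSpace Ω] (P : Measure Ω) [IsProbabilityMeasure P]
    (B : ℝ≥0 → Ω → ℝ) (hB : IsBrownianReal B P)
    (ξ : Ω → ℝ) (hξ : MemLp ξ 3 P) (hindep : IndepFun ξ (fun ω t => B t ω) P)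
    (α θ σ μ₀ : ℝ) :
    ∃ (x : ℝ≥0 → Ω → ℝ) (μ : ℝ → ℝ),
      CubicMcKeanVlasov.IsStrongSolution P α θ σ μ₀ B ξ x μ ∧
      ∀ (y : ℝ≥0 → Ω → ℝ) (ν : ℝ → ℝ),
        CubicMcKeanVlasov.IsSolution P α θ σ μ₀ B ξ y ν →
          (∀ᵐ ω ∂P, ∀ t, y t ω = x t ω) ∧ ∀ t : ℝ, 0 ≤ t → ν t = μ t := by
  obtain ⟨W, hW, hWB⟩ := CubicMcKeanVlasov.exists_isNoise hB σ
  have hξm := hξ.aestronglyMeasurable.aemeasurable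
  have hξ' := hξm.measurable_mk
  have hξξ' : hξm.mk ξ =ᵐ[P] ξ := hξm.ae_eq_mk.symm
  have hξ'3 : Integrable (fun ω => |hξm.mk ξ ω| ^ 3) P :=
    ((memLp_congr_ae hξξ').2 hξ).integrable_norm_pow (p := 3) (by norm_num)
  obtain ⟨m, hm, huniq⟩ :=
    CubicMcKeanVlasov.existsUnique_meanField hξ' hξ'3 hW α θ μ₀
  refine ⟨_, m, CubicMcKeanVlasov.isStrongSolution_process hξ' hξ'3 hξξ' hW hWB hm,
    fun y ν h => ?_⟩
  obtain ⟨m', hm'ν, hy, hm'⟩ := h.exists_eq_process hξ' hξ'3 hξξ' hW hWB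
  have heq := huniq m' hm'
  refine ⟨?_, fun t ht => by rw [← hm'ν t ht, heq t ht]⟩
  filter_upwards [hy] with ω hω t
  rw [hω t]
  -- The drivers `m'` and `m` agree on nonnegative times, hence so do the paths they drive.
  exact (CubicMcKeanVlasov.solves_sol _ _ m').eq_of_eqOn (CubicMcKeanVlasov.solves_sol _ _ m)
    (le_max_right _ _) (fun _ _ => rfl) fun s hs => heq s hs.1
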